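/- Let $W$ be a group. A subset $S\subseteq W$ is called a Coxeter generating set of $W$ if every element of $S$ has order $2$ and $W$ is given by the presentation $\langle S \mid (st)^{m_{s,t}}=1 \text{ for } s,t\in S \text{ with } m_{s,t}\neq\infty\rangle$, where $m_{s,t}\in\{1,2,\dots\}\cup\{\infty\}$ is the order of $st$ in $W$; the matrix $(m_{s,t})_{s,t\in S}$ is then called the type of $(W,S)$, and is said to be a type admitted by $W$. Two types $(m_{s,t})_{s,t\in S}$ and $(m'_{s',t'})_{s',t'\in S'}$ are isomorphic if there is a bijection $f:S\to S'$ with $m'_{f(s),f(t)}=m_{s,t}$ for all $s,t\in S$. The group $W$ is a right-angled Coxeter group if it admits a Coxeter generating set $S$, of finite or infinite cardinality, whose type has all its entries in $\{1,2,\infty\}$. Theorem. Every right-angled Coxeter group $W$, of finite or infinite rank, is rigid: all the types admitted by $W$ are isomorphic; equivalently, for any two Coxeter generating sets $S$ and $S'$ of $W$ there is an automorphism $\alpha$ of $W$ such that $\alpha(S)=S'$. -/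

import Mathlib

/-- The matrix `(m s t)` with `m s t` the order of `s * t`, for a set `S` of elements of order two.
As in Mathlib's Coxeter matrices, the entry `0` encodes `∞` (and `orderOf x = 0` if and only if
`x` has infinite order). -/
noncomputable def orderMatrix {W : Type*} [Group W] (S : Set W) (hS : ∀ s ∈ S, orderOf s = 2) :
    CoxeterMatrix S where
  M := Matrix.of fun s t : S => orderOf ((s : W) * (t : W))
  isSymm := by
    ext s t
    have hs : (s : W)⁻¹ = s := inv_eq_of_mul_eq_one_left (by
      rw [← pow_two, ← hS s s.2, pow_orderOf_eq_one])
    have ht : (t : W)⁻¹ = t := inv_eq_of_mul_eq_one_left (by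
      rw [← pow_two, ← hS t t.2, pow_orderOf_eq_one])
    show orderOf ((t : W) * (s : W)) = orderOf ((s : W) * (t : W))
    rw [← orderOf_inv, mul_inv_rev, hs, ht]
  diagonal s := by
    show orderOf ((s : W) * (s : W)) = 1
    rw [orderOf_eq_one_iff, ← pow_two, ← hS s s.2, pow_orderOf_eq_one]
  off_diagonal s t hst h := by
    have ht : (t : W)⁻¹ = t := inv_eq_of_mul_eq_one_left (by
      rw [← pow_two, ← hS t t.2, pow_orderOf_eq_one])
    have h1 : (s : W) * (t : W) = 1 := orderOf_eq_one_iff.mp h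
    exact hst (Subtype.ext ((eq_inv_of_mul_eq_one_left h1).trans ht))

/-- `S` is a Coxeter generating set of `W`: its elements have order two, and the inclusion of `S`
in `W` induces an isomorphism between the group presented by
`⟨S | (s t) ^ m s t = 1, for s, t ∈ S with m s t ≠ ∞⟩` and `W`, where `m s t` is the order of `s t`
in `W`. -/
structure IsCoxeterSet {W : Type*} [Group W] (S : Set W) : Prop where
  orderOf_eq_two : ∀ s ∈ S, orderOf s = 2
  presentation : ∃ cs : CoxeterSystem (orderMatrix S orderOf_eq_two) W, ∀ s : S, cs.simple s = s

/-- The type of the Coxeter system `(W, S)`. -/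
noncomputable def IsCoxeterSet.type {W : Type*} [Group W] {S : Set W} (hS : IsCoxeterSet S) : CoxeterMatrix S :=
  orderMatrix S hS.orderOf_eq_two

/-- A Coxeter matrix is right-angled if its entries belong to `{1, 2, ∞}` (`0` encodes `∞`). -/
def CoxeterMatrix.IsRightAngled {B : Type*} (M : CoxeterMatrix B) : Prop :=
  ∀ i j, M i j = 1 ∨ M i j = 2 ∨ M i j = 0

/-- Two Coxeter matrices are isomorphic if some bijection between the index sets respects the
entries. -/
def CoxeterMatrix.Isomorphic {B B' : Type*} (M : CoxeterMatrix B) (M' : CoxeterMatrix B') : Prop :=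
  ∃ e : B ≃ B', ∀ i j, M' (e i) (e j) = M i j

/-- `W` is a right-angled Coxeter group: it admits a Coxeter system of right-angled type. -/
def IsRightAngledCoxeterGroup (W : Type*) [Group W] : Prop :=
  ∃ (S : Set W) (hS : IsCoxeterSet S), hS.type.IsRightAngled

/-- `W` is rigid: all the types that `W` admits are isomorphic. -/
def IsRigid (W : Type*) [Group W] : Prop :=
  ∀ (S S' : Set W) (hS : IsCoxeterSet S) (hS' : IsCoxeterSet S'), hS.type.Isomorphic hS'.type

/-!
The Tits representation of a right-angled Coxeter group `W` can be written over `ℤ`, it is faithful,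
and every reflection in it is congruent to the identity modulo `2`. By Minkowski's argument an
integral matrix of finite order that is congruent to the identity modulo `2` has square one, so
every torsion element of `W` has order at most two. Hence every Coxeter generating set of `W` is
right-angled.

A right-angled Coxeter generating set yields a basis of the vector space `W^ab` over `𝔽₂`, and the
images of the elements `a` with `a * a = 1` are exactly the vectors whose support is a clique of the
commutation graph. This set of vectors determines when the supports of two vectors span a joint
clique. Ordering vectors by the inclusion between the sets of vectors so related to them gives a
filtration of `W^ab` by spans, and the dimension of each subquotient counts the basis vectors of a
given class; matching the classes for two bases is an isomorphism of the commutation graphs.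
-/

namespace RightAngledCoxeter

section LevelTwo

variable {R : Type*} [Ring R]

theorem eq_zero_of_mul_one_add_two_mul_eq_zero (hsep : ∀ a : R, (∀ k, 2 ^ k ∣ a) → a = 0) {a c : R}
    (h : a * (1 + 2 * c) = 0) : a = 0 := by
  have hdiv : a = 2 * (a * -c) := by
    rw [mul_neg, mul_neg, ← add_eq_zero_iff_eq_neg, ← h, mul_add, mul_one, ← mul_assoc a,
      ← (Commute.ofNat_left 2 a).eq, mul_assoc]
  refine hsep a fun k => ?_
  induction k with
  | zero => rw [pow_zero]; exact one_dvd a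
  | succ k ih =>
    rw [hdiv, pow_succ']
    exact mul_dvd_mul_left 2 (ih.mul_right _)

theorem eq_one_of_odd_of_pow_eq_one (hsep : ∀ a : R, (∀ k, 2 ^ k ∣ a) → a = 0) {g : R}
    (hg : 2 ∣ g - 1) {n : ℕ} (hn : Odd n) (h : g ^ n = 1) : g = 1 := by
  obtain ⟨m, rfl⟩ := hn
  have hsum : 2 ∣ ∑ i ∈ Finset.range (2 * m + 1), (g ^ i - 1) :=
    Finset.dvd_sum fun i _ => hg.trans (Dvd.intro _ (mul_geom_sum g i))
  rw [Finset.sum_sub_distrib, Finset.sum_const, Finset.card_range, nsmul_one] at hsum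
  obtain ⟨c, hc⟩ := hsum
  have hunit : ∑ i ∈ Finset.range (2 * m + 1), g ^ i = 1 + 2 * (m + c) := by
    rw [sub_eq_iff_eq_add.mp hc]
    push_cast
    noncomm_ring
  refine sub_eq_zero.mp (eq_zero_of_mul_one_add_two_mul_eq_zero hsep (c := m + c) ?_)
  rw [← hunit, mul_geom_sum, h, sub_self]

theorem eq_one_of_four_dvd_sub_one_of_mul_self_eq_one [IsAddTorsionFree R]
    (hsep : ∀ a : R, (∀ k, 2 ^ k ∣ a) → a = 0) {g : R} (hg : 4 ∣ g - 1) (h : g * g = 1) :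
    g = 1 := by
  obtain ⟨c, hc⟩ := hg
  refine sub_eq_zero.mp (eq_zero_of_mul_one_add_two_mul_eq_zero hsep (c := c) ?_)
  have hdouble : 2 • ((g - 1) * (1 + 2 * c)) = 0 := by
    calc 2 • ((g - 1) * (1 + 2 * c)) = (g - 1) * (4 * c + 1 + 1) := by noncomm_ring
      _ = g * g - 1 := by rw [← hc]; noncomm_ring
      _ = 0 := by rw [h, sub_self]
  exact (smul_eq_zero_iff_right two_ne_zero).mp hdouble

theorem eq_one_of_four_dvd_sub_one_of_pow_eq_one [IsAddTorsionFree R]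
    (hsep : ∀ a : R, (∀ k, 2 ^ k ∣ a) → a = 0) {g : R} (hg : 4 ∣ g - 1) {n : ℕ} (hn : 0 < n)
    (h : g ^ n = 1) : g = 1 := by
  induction n using Nat.strong_induction_on with
  | _ n ih =>
    rcases n.even_or_odd with ⟨m, rfl⟩ | hodd
    · refine ih m (by omega) (by omega)
        (eq_one_of_four_dvd_sub_one_of_mul_self_eq_one hsep ?_ (by rw [← pow_add, h]))
      exact hg.trans (Dvd.intro _ (mul_geom_sum g m))
    · exact eq_one_of_odd_of_pow_eq_one hsep ((Dvd.intro 2 (by norm_num)).trans hg) hodd h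

theorem mul_self_eq_one_of_two_dvd_sub_one_of_isOfFinOrder [IsAddTorsionFree R]
    (hsep : ∀ a : R, (∀ k, 2 ^ k ∣ a) → a = 0) {g : R} (hg : 2 ∣ g - 1) (h : IsOfFinOrder g) :
    g * g = 1 := by
  obtain ⟨n, hn, hgn⟩ := h.exists_pow_eq_one
  refine eq_one_of_four_dvd_sub_one_of_pow_eq_one hsep ?_ hn
    (by rw [← pow_two, ← pow_mul, mul_comm, pow_mul, hgn, one_pow])
  obtain ⟨c, hc⟩ := hg
  refine ⟨c + c * c, ?_⟩
  rw [sub_eq_iff_eq_add.mp hc]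
  noncomm_ring

theorem eq_zero_of_forall_two_pow_dvd_end {B : Type*} {f : Module.End ℤ (B → ℤ)}
    (h : ∀ k, 2 ^ k ∣ f) : f = 0 := by
  ext c t
  by_contra hne
  obtain ⟨k, hk⟩ := Int.finiteMultiplicity_iff.mpr ⟨(by decide : (2 : ℤ).natAbs ≠ 1), hne⟩
  obtain ⟨g, rfl⟩ := h (k + 1)
  refine hk ⟨g c t, ?_⟩
  rw [Module.End.mul_apply, ← Nat.cast_ofNat, ← Nat.cast_pow, Module.End.natCast_apply,
    Pi.smul_apply, nsmul_eq_mul, Nat.cast_pow, Nat.cast_ofNat]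

end LevelTwo

section TitsRepresentation

variable {B W : Type*} [Group W] {M : CoxeterMatrix B}

theorem coxeterMatrix_eq_one_iff {s t : B} : M s t = 1 ↔ s = t :=
  ⟨fun h => by_contra fun hst => M.off_diagonal s t hst h, by rintro rfl; exact M.diagonal s⟩

theorem isLiftable_of_isRightAngled {G : Type*} [Monoid G] (hM : M.IsRightAngled) {f : B → G}
    (hsq : ∀ s, f s * f s = 1) (hcomm : ∀ s t, M s t = 2 → Commute (f s) (f t)) :
    M.IsLiftable f := by
  intro s t
  rcases hM s t with h | h | h
  · rw [coxeterMatrix_eq_one_iff.mp h, hsq, one_pow]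
  · rw [h, (hcomm s t h).mul_pow, pow_two, pow_two, hsq, hsq, one_mul]
  · rw [h, pow_zero]

variable (M) in
/-- The row of the simple root `s` in the Gram matrix `-cos (π / M s t)` of the canonical bilinear
form of a right-angled Coxeter matrix `M`. -/
def gramVector (s : B) : B → ℤ := fun t =>
  match M s t with
  | 0 => -1
  | 1 => 1
  | _ => 0

theorem gramVector_self (s : B) : gramVector M s s = 1 := by
  simp only [gramVector, M.diagonal]

theorem gramVector_of_eq_two {s t : B} (h : M s t = 2) : gramVector M s t = 0 := by
  simp only [gramVector, h]

theorem gramVector_of_eq_zero {s t : B} (h : M s t = 0) : gramVector M s t = -1 := by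
  simp only [gramVector, h]

variable (M) in
/-- The action of the simple reflection `s` on linear forms, a form being encoded by its values on
the simple roots. -/
def titsReflection (s : B) : Module.End ℤ (B → ℤ) :=
  Module.preReflection (2 • gramVector M s) (LinearMap.proj s)

theorem titsReflection_apply (s : B) (c : B → ℤ) (t : B) :
    titsReflection M s c t = c t - 2 * c s * gramVector M s t := by
  simp only [titsReflection, Module.preReflection_apply, LinearMap.proj_apply, Pi.sub_apply,
    Pi.smul_apply, smul_eq_mul, two_nsmul, Pi.add_apply]
  ring

theorem titsReflection_mul_self (s : B) : titsReflection M s * titsReflection M s = 1 := by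
  refine LinearMap.ext (Module.involutive_preReflection ?_)
  simp [gramVector_self]

theorem commute_titsReflection {s t : B} (h : M s t = 2) :
    Commute (titsReflection M s) (titsReflection M t) := by
  have h' : M t s = 2 := by rw [M.symmetric, h]
  refine LinearMap.ext fun c => funext fun u => ?_
  simp only [Module.End.mul_apply, titsReflection_apply, gramVector_of_eq_two h,
    gramVector_of_eq_two h']
  ring

theorem two_dvd_titsReflection_sub_one (s : B) : 2 ∣ titsReflection M s - 1 := by
  refine ⟨-(LinearMap.proj s).smulRight (gramVector M s), ?_⟩
  ext c t
  simp only [two_mul, LinearMap.sub_apply, LinearMap.add_apply, LinearMap.neg_apply, Pi.sub_apply,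
    Pi.add_apply, Pi.neg_apply, Module.End.one_apply, titsReflection_apply,
    LinearMap.smulRight_apply, LinearMap.proj_apply, Pi.smul_apply, smul_eq_mul]
  ring

theorem titsReflection_apply_self (s : B) (c : B → ℤ) : titsReflection M s c s = -c s := by
  rw [titsReflection_apply, gramVector_self]
  ring

theorem le_titsReflection_apply (hM : M.IsRightAngled) {s t : B} (hst : s ≠ t) {c : B → ℤ}
    (hs : 0 ≤ c s) : c t ≤ titsReflection M s c t := by
  rw [titsReflection_apply]
  rcases hM s t with h | h | h
  · exact absurd (coxeterMatrix_eq_one_iff.mp h) hst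
  · rw [gramVector_of_eq_two h]
    lia
  · rw [gramVector_of_eq_zero h]
    lia

theorem titsReflection_add_pos (hM : M.IsRightAngled) {u : B} {c : B → ℤ} (hu : 0 < c u)
    (hc : ∀ s t, M s t = 0 → 0 < c s + c t) {s t : B} (hst : M s t = 0) :
    0 < titsReflection M u c s + titsReflection M u c t := by
  wlog hsu : u ≠ t generalizing s t
  · rw [add_comm]
    refine this (by rw [M.symmetric, hst]) ?_
    rintro rfl
    obtain rfl := not_not.mp hsu
    simp at hst
  have hct := le_titsReflection_apply hM hsu hu.le
  rcases eq_or_ne u s with rfl | hus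
  · rw [titsReflection_apply_self, titsReflection_apply, gramVector_of_eq_zero hst]
    linarith [hc _ _ hst]
  · linarith [hc s t hst, le_titsReflection_apply hM hus hu.le]

variable (cs : CoxeterSystem M W) (hM : M.IsRightAngled)

/-- The contragredient Tits representation of a right-angled Coxeter group. It is defined over `ℤ`
because the entries of the doubled Gram matrix are integers. -/
noncomputable def titsRep : W →* Module.End ℤ (B → ℤ) :=
  cs.lift ⟨titsReflection M, isLiftable_of_isRightAngled hM titsReflection_mul_self
    fun _ _ => commute_titsReflection⟩

theorem titsRep_simple (s : B) : titsRep cs hM (cs.simple s) = titsReflection M s :=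
  cs.lift_apply_simple _ s

theorem two_dvd_titsRep_sub_one (w : W) : 2 ∣ titsRep cs hM w - 1 := by
  induction w using cs.simple_induction with
  | simple s => rw [titsRep_simple]; exact two_dvd_titsReflection_sub_one s
  | one => rw [map_one, sub_self]; exact dvd_zero 2
  | mul w w' h h' =>
    rw [map_mul, show titsRep cs hM w * titsRep cs hM w' - 1 = (titsRep cs hM w - 1) *
      titsRep cs hM w' + (titsRep cs hM w' - 1) by noncomm_ring]
    exact dvd_add (h.mul_right _) h'

theorem commute_simple_of_eq_two {s t : B} (h : M s t = 2) :
    Commute (cs.simple s) (cs.simple t) := by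
  have hpow := cs.simple_mul_simple_pow s t
  rw [h, pow_two, mul_eq_one_iff_eq_inv, mul_inv_rev, cs.inv_simple, cs.inv_simple] at hpow
  exact hpow

theorem not_isLeftDescent_simple_mul_of_eq_two {u s : B} (hus : M u s = 2) {w : W}
    (hu : cs.IsLeftDescent w u) (hs : ¬cs.IsLeftDescent w s) :
    ¬cs.IsLeftDescent (cs.simple u * w) s := by
  have hcomm : cs.simple s * w = cs.simple u * (cs.simple s * (cs.simple u * w)) := by
    rw [(commute_simple_of_eq_two cs hus).symm.left_comm, cs.simple_mul_simple_cancel_left]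
  intro hs'
  have hle := cs.length_mul_le (cs.simple u) (cs.simple s * (cs.simple u * w))
  rw [← hcomm, cs.length_simple, cs.not_isLeftDescent_iff.mp hs] at hle
  rw [cs.isLeftDescent_iff] at hu hs'
  lia

/- If `u * s` has infinite order, the reflection in `u` turns the value `c s`, which may be
negative, into `c s + 2 * c u`. The bound on sums of pairs makes this positive. -/
theorem titsRep_apply_one_pos (w : W) :
    (∀ s t, M s t = 0 → 0 < titsRep cs hM w 1 s + titsRep cs hM w 1 t) ∧
      ∀ s, ¬cs.IsLeftDescent w s → 0 < titsRep cs hM w 1 s := by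
  induction hn : cs.length w using Nat.strong_induction_on generalizing w with
  | _ n ih =>
    rcases eq_or_ne w 1 with rfl | hw
    · simp
    obtain ⟨u, hu⟩ := cs.exists_leftDescent_of_ne_one hw
    obtain ⟨hpair, hpos⟩ := ih _ (hn ▸ hu) (cs.simple u * w) rfl
    have hu' := hpos u (cs.isLeftDescent_iff_not_isLeftDescent_mul.mp hu)
    have hact : titsRep cs hM w 1 = titsReflection M u (titsRep cs hM (cs.simple u * w) 1) := by
      rw [← titsRep_simple cs hM, ← Module.End.mul_apply, ← map_mul,
        cs.simple_mul_simple_cancel_left]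
    rw [hact]
    refine ⟨fun s t => titsReflection_add_pos hM hu' hpair, fun s hs => ?_⟩
    rcases hM u s with h | h | h
    · obtain rfl := coxeterMatrix_eq_one_iff.mp h
      exact absurd hu hs
    · rw [titsReflection_apply, gramVector_of_eq_two h, mul_zero, sub_zero]
      exact hpos s (not_isLeftDescent_simple_mul_of_eq_two cs h hu hs)
    · rw [titsReflection_apply, gramVector_of_eq_zero h]
      linarith [hpair u s h]

theorem titsRep_injective : Function.Injective (titsRep cs hM) := by
  refine (injective_iff_map_eq_one _).mpr fun w hw => ?_
  by_contra hne
  obtain ⟨s, hs⟩ := cs.exists_leftDescent_of_ne_one hne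
  have hpos := (titsRep_apply_one_pos cs hM (cs.simple s * w)).2 s
    (cs.isLeftDescent_iff_not_isLeftDescent_mul.mp hs)
  rw [map_mul, hw, mul_one, titsRep_simple, titsReflection_apply_self] at hpos
  simp at hpos

include cs hM in
theorem mul_self_eq_one_of_isOfFinOrder {w : W} (hw : IsOfFinOrder w) : w * w = 1 := by
  have : IsAddTorsionFree (Module.End ℤ (B → ℤ)) :=
    Module.isTorsionFree_nat_iff_isAddTorsionFree.mp inferInstance
  refine titsRep_injective cs hM ?_
  rw [map_mul, map_one]
  exact mul_self_eq_one_of_two_dvd_sub_one_of_isOfFinOrder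
    (fun _ => eq_zero_of_forall_two_pow_dvd_end) (two_dvd_titsRep_sub_one cs hM w)
    ((titsRep cs hM).isOfFinOrder hw)

end TitsRepresentation

section CliqueSupport

open Module Submodule

/-- The vectors related to everything to which `x` is related, for a relation `Q`. For the clique
relation this is the analogue of the set of vertices whose star contains the star of a clique. -/
def starClosure {V : Type*} (Q : V → V → Prop) (x : V) : Set V := {z | ∀ y, Q x y → Q z y}

theorem mem_starClosure_self {V : Type*} (Q : V → V → Prop) (x : V) : x ∈ starClosure Q x :=
  fun _ h => h

theorem starClosure_subset_iff {V : Type*} {Q : V → V → Prop} {x z : V} :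
    starClosure Q z ⊆ starClosure Q x ↔ z ∈ starClosure Q x :=
  ⟨fun h => h (mem_starClosure_self Q z), fun h _ hu y hy => hu y (h y hy)⟩

theorem nonempty_basis_map_mkQ_span_image {ι R M : Type*} [Ring R] [AddCommGroup M] [Module R M]
    {v : ι → M} (hv : LinearIndependent R v) (A A' : Set ι) :
    Nonempty (Basis ↥(A \ A') R ((span R (v '' A)).map (span R (v '' A')).mkQ)) := by
  set q := (span R (v '' A')).mkQ
  have hli : LinearIndepOn R (q ∘ v) (A \ A') :=
    ((linearIndepOn_union_iff_quotient Set.disjoint_sdiff_right).mp (hv.linearIndepOn _)).2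
  have hspan : span R (Set.range fun t : ↥(A \ A') => (q ∘ v) t) = (span R (v '' A)).map q := by
    rw [map_span, ← Set.image_eq_range, Set.image_comp]
    refine le_antisymm (span_mono (by gcongr; exact Set.sdiff_subset)) (span_le.mpr ?_)
    rintro _ ⟨_, ⟨t, ht, rfl⟩, rfl⟩
    by_cases ht' : t ∈ A'
    · have hzero : q (v t) = 0 := (Quotient.mk_eq_zero _).mpr (subset_span ⟨t, ht', rfl⟩)
      rw [hzero]
      exact zero_mem _
    · exact subset_span ⟨v t, ⟨t, ⟨ht, ht'⟩, rfl⟩, rfl⟩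
  rw [← hspan]
  exact ⟨Basis.span hli⟩

variable {ι ι' K V : Type*} [DivisionRing K] [AddCommGroup V] [Module K V]

/-- Vectors `x` and `y` are clique-related if the basis vectors that occur in `x` or in `y` are
pairwise adjacent. -/
def CliqueRel (b : Basis ι K V) (G : SimpleGraph ι) (x y : V) : Prop :=
  G.IsClique ((b.repr x).support ∪ (b.repr y).support)

variable (b : Basis ι K V) (G : SimpleGraph ι)

theorem cliqueRel_comm {x y : V} : CliqueRel b G x y ↔ CliqueRel b G y x := by
  rw [CliqueRel, Set.union_comm, CliqueRel]

theorem cliqueRel_iff {x y : V} :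
    CliqueRel b G x y ↔ G.IsClique (b.repr x).support ∧ G.IsClique (b.repr y).support ∧
      G.IsClique (b.repr (x + y)).support := by
  classical
  constructor
  · refine fun h => ⟨h.subset Set.subset_union_left, h.subset Set.subset_union_right, h.subset ?_⟩
    rw [map_add, ← Finset.coe_union]
    exact Finset.coe_subset.mpr Finsupp.support_add
  · rintro ⟨hx, hy, hxy⟩
    have hcross : ∀ s ∈ (b.repr x).support, ∀ t ∈ (b.repr y).support, s ≠ t → G.Adj s t := by
      intro s hs t ht hst
      -- A vertex lying in only one of the two supports survives in the support of the sum.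
      by_cases hs' : s ∈ (b.repr y).support
      · exact hy hs' ht hst
      by_cases ht' : t ∈ (b.repr x).support
      · exact hx hs ht' hst
      · refine hxy ?_ ?_ hst <;> simp_all
    rintro s (hs | hs) t (ht | ht) hst
    · exact hx hs ht hst
    · exact hcross s hs t ht hst
    · exact (hcross t ht s hs hst.symm).symm
    · exact hy hs ht hst

theorem cliqueRel_basis_iff {s t : ι} : CliqueRel b G (b s) (b t) ↔ (s ≠ t → G.Adj s t) := by
  rw [CliqueRel, b.repr_self, b.repr_self, Finsupp.support_single s one_ne_zero,
    Finsupp.support_single t one_ne_zero, Finset.coe_singleton, Finset.coe_singleton,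
    Set.singleton_union, SimpleGraph.isClique_pair]

theorem mem_starClosure_iff {x z : V} :
    z ∈ starClosure (CliqueRel b G) x ↔
      ∀ t ∈ (b.repr z).support, b t ∈ starClosure (CliqueRel b G) x := by
  constructor
  · intro hz t ht y hxy
    refine (hz y hxy).subset (Set.union_subset_union_left _ ?_)
    simpa using ht
  · intro hz y hxy
    have hx : CliqueRel b G x x := hxy.subset (by simp)
    have hzy : ∀ t ∈ (b.repr z).support, CliqueRel b G (b t) y := fun t ht => hz t ht y hxy
    have hzz : ∀ t ∈ (b.repr z).support, ∀ u ∈ (b.repr z).support, CliqueRel b G (b t) (b u) :=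
      fun t ht u hu => hz t ht _ ((cliqueRel_comm b G).mp (hz u hu x hx))
    rintro t (ht | ht) u (hu | hu) htu
    · exact (cliqueRel_basis_iff b G).mp (hzz t ht u hu) htu
    · exact hzy t ht (by simp) (Or.inr hu) htu
    · exact hzy u hu (Or.inr ht) (by simp) htu
    · exact hxy (Or.inr ht) (Or.inr hu) htu

theorem span_preimage_starClosure {𝒟 : Set (Set V)} (h𝒟 : IsLowerSet 𝒟) :
    span K (starClosure (CliqueRel b G) ⁻¹' 𝒟) =
      span K (b '' {t | starClosure (CliqueRel b G) (b t) ∈ 𝒟}) := by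
  refine le_antisymm (span_le.mpr fun x hx => ?_) (span_mono (by rintro _ ⟨t, ht, rfl⟩; exact ht))
  refine (b.mem_span_image).mpr fun t ht => h𝒟 ?_ hx
  exact starClosure_subset_iff.mpr
    ((mem_starClosure_iff b G).mp (mem_starClosure_self _ x) t ht)

/- The subquotient on the right is built from the clique relation alone, so the number of basis
vectors with a given star closure does not depend on the basis. -/
theorem nonempty_basis_starClosure_fiber (E : Set V) :
    Nonempty (Basis {t // starClosure (CliqueRel b G) (b t) = E} K
      ((span K (starClosure (CliqueRel b G) ⁻¹' Set.Iic E)).map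
        (span K (starClosure (CliqueRel b G) ⁻¹' Set.Iio E)).mkQ)) := by
  rw [span_preimage_starClosure b G (isLowerSet_Iic E),
    span_preimage_starClosure b G (isLowerSet_Iio E)]
  obtain ⟨c⟩ := nonempty_basis_map_mkQ_span_image b.linearIndependent
    {t | starClosure (CliqueRel b G) (b t) ∈ Set.Iic E}
    {t | starClosure (CliqueRel b G) (b t) ∈ Set.Iio E}
  exact ⟨c.reindex (Equiv.subtypeEquivRight fun t =>
    Set.ext_iff.mp (Set.Iic_sdiff_Iio_same (a := E)) _)⟩

variable {b G}

theorem nonempty_iso_of_isClique_support_iff {b' : Basis ι' K V} {G' : SimpleGraph ι'}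
    (h : ∀ x, G.IsClique (b.repr x).support ↔ G'.IsClique (b'.repr x).support) :
    Nonempty (G ≃g G') := by
  have hrel : CliqueRel b G = CliqueRel b' G' := by
    ext x y
    simp only [cliqueRel_iff, h]
  have hfiber (E : Set V) : Nonempty ({t // starClosure (CliqueRel b G) (b t) = E} ≃
      {t // starClosure (CliqueRel b G) (b' t) = E}) := by
    obtain ⟨c⟩ := nonempty_basis_starClosure_fiber b G E
    obtain ⟨c'⟩ := nonempty_basis_starClosure_fiber b' G' E
    rw [← hrel] at c'
    exact ⟨c.indexEquiv c'⟩
  let e : ι ≃ ι' := Equiv.ofFiberEquiv (f := fun t => starClosure (CliqueRel b G) (b t))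
    (g := fun t => starClosure (CliqueRel b G) (b' t)) fun E => (hfiber E).some
  have he (s : ι) : starClosure (CliqueRel b G) (b' (e s)) = starClosure (CliqueRel b G) (b s) :=
    Equiv.ofFiberEquiv_map (f := fun t => starClosure (CliqueRel b G) (b t))
      (g := fun t => starClosure (CliqueRel b G) (b' t)) _ s
  have hcongr (s : ι) (y : V) : CliqueRel b G (b' (e s)) y ↔ CliqueRel b G (b s) y :=
    ⟨fun H => (he s ▸ mem_starClosure_self _ _ : b s ∈ starClosure _ (b' (e s))) y H,
      fun H => ((he s).symm ▸ mem_starClosure_self _ _ : b' (e s) ∈ starClosure _ (b s)) y H⟩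
  refine ⟨e, fun {s t} => ?_⟩
  have hadj : (e s ≠ e t → G'.Adj (e s) (e t)) ↔ (s ≠ t → G.Adj s t) := by
    rw [← cliqueRel_basis_iff b, ← cliqueRel_basis_iff b', ← hrel, hcongr, cliqueRel_comm, hcongr,
      cliqueRel_comm]
  by_cases hst : s = t
  · simp [hst]
  · simpa [hst] using hadj

end CliqueSupport

section Abelianization

open Module

variable {B W : Type*} [Group W] {M : CoxeterMatrix B} (cs : CoxeterSystem M W)

include cs in
theorem two_nsmul_abelianization_eq_zero (x : Additive (Abelianization W)) : 2 • x = 0 := by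
  have hpow : powMonoidHom 2 = (1 : Abelianization W →* Abelianization W) := by
    refine Abelianization.hom_ext _ _ (cs.ext_simple fun s => ?_)
    rw [MonoidHom.comp_apply, powMonoidHom_apply, ← map_pow, cs.simple_sq, map_one,
      MonoidHom.comp_apply, MonoidHom.one_apply]
  exact DFunLike.congr_fun hpow x.toMul

variable [Module (ZMod 2) (Additive (Abelianization W))]

theorem span_range_ofMul_of_simple :
    Submodule.span (ZMod 2) (Set.range fun s => Additive.ofMul (Abelianization.of (cs.simple s))) =
      ⊤ := by
  refine eq_top_iff.mpr fun x _ => ?_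
  obtain ⟨w, rfl⟩ : ∃ w, Additive.ofMul (Abelianization.of w) = x := QuotientGroup.mk_surjective _
  induction w using cs.simple_induction with
  | simple s => exact Submodule.subset_span ⟨s, rfl⟩
  | one => exact zero_mem _
  | mul w w' h h' => exact add_mem (h trivial) (h' trivial)

variable (hM : M.IsRightAngled)

/-- The linear map on the abelianization of a right-angled Coxeter group that counts, modulo two,
the occurrences of each simple reflection. -/
noncomputable def simpleCount : Additive (Abelianization W) →ₗ[ZMod 2] (B →₀ ZMod 2) :=
  (MonoidHom.toAdditiveLeft (Abelianization.lift (cs.lift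
    ⟨fun s => Multiplicative.ofAdd (Finsupp.single s 1), isLiftable_of_isRightAngled hM
      (fun s => ZModModule.add_self (Finsupp.single s (1 : ZMod 2)))
      fun _ _ _ => Commute.all _ _⟩))).toZModLinearMap 2

theorem simpleCount_simple (s : B) :
    simpleCount cs hM (.ofMul (.of (cs.simple s))) = Finsupp.single s 1 := by
  change Multiplicative.toAdd (Abelianization.lift (cs.lift _) (.of (cs.simple s))) = _
  rw [Abelianization.lift_apply_of, cs.lift_apply_simple, toAdd_ofAdd]

/-- The basis formed by the simple reflections of the abelianization of a right-angled Coxeter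
group, an elementary abelian `2`-group. -/
noncomputable def abelianizationBasis : Basis B (ZMod 2) (Additive (Abelianization W)) :=
  Basis.mk (v := fun s => Additive.ofMul (Abelianization.of (cs.simple s)))
    (.of_comp (simpleCount cs hM) <| by
      simpa only [Function.comp_def, simpleCount_simple, Finsupp.coe_basisSingleOne] using
        (Finsupp.basisSingleOne (R := ZMod 2) (ι := B)).linearIndependent)
    (span_range_ofMul_of_simple cs).ge

theorem abelianizationBasis_apply (s : B) :
    abelianizationBasis cs hM s = .ofMul (.of (cs.simple s)) :=
  Basis.mk_apply _ _ s

theorem ofAdd_abelianizationBasis_repr_eq {s : B} {χ : W →* Multiplicative (ZMod 2)}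
    (hχ : ∀ t, χ (cs.simple t) = .ofAdd (Finsupp.single t 1 s)) (w : W) :
    .ofAdd ((abelianizationBasis cs hM).repr (Additive.ofMul (.of w)) s) = χ w := by
  induction w using cs.simple_induction with
  | simple t => rw [hχ, ← abelianizationBasis_apply cs hM, Basis.repr_self]
  | one =>
    rw [map_one Abelianization.of, ofMul_one, map_zero, Finsupp.zero_apply, ofAdd_zero, map_one]
  | mul w w' h h' =>
    rw [map_mul Abelianization.of, ofMul_mul, map_add, Finsupp.add_apply, ofAdd_add, h, h', map_mul]

end Abelianization

section Involutions

open DihedralGroup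

/-- The two characters of the dihedral group of order `8` that are nontrivial on the rotation
`r 1`, indexed by their value at the reflection `sr 0`. -/
def dihedralParity (ε : ZMod 2) : DihedralGroup 4 →* Multiplicative (ZMod 2) where
  toFun
    | r i => .ofAdd (i.cast)
    | sr i => .ofAdd (i.cast + ε)
  map_one' := rfl
  map_mul' := by revert ε; decide

theorem dihedralParity_eq_one_or_of_mul_self_eq_one {a : DihedralGroup 4} (ha : a * a = 1) :
    dihedralParity 0 a = 1 ∨ dihedralParity 1 a = 1 := by
  revert a; decide

variable {B W : Type*} [Group W] {M : CoxeterMatrix B}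

variable (M) in
/-- The graph joining two distinct simple reflections if they commute. -/
def commGraph : SimpleGraph B where
  Adj s t := M s t = 2
  symm := ⟨fun s t h => by rw [M.symmetric, h]⟩
  loopless := ⟨fun s => by rw [M.diagonal]; decide⟩

theorem commGraph_adj {s t : B} : (commGraph M).Adj s t ↔ M s t = 2 :=
  Iff.rfl

variable (cs : CoxeterSystem M W) (hM : M.IsRightAngled)

include hM in
theorem exists_hom_dihedralGroup [DecidableEq B] {p q : B} (hpq : M p q = 0) :
    ∃ δ : W →* DihedralGroup 4, ∀ s,
      δ (cs.simple s) = if s = p then sr 0 else if s = q then sr 1 else 1 := by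
  have hqp : M q p = 0 := by rw [M.symmetric, hpq]
  refine ⟨cs.lift ⟨_, isLiftable_of_isRightAngled hM (fun s => ?_) fun s t hst => ?_⟩,
    cs.lift_apply_simple _⟩
  · split_ifs <;> decide
  · rw [commute_iff_eq]
    split_ifs <;> first | decide | simp_all

variable [Module (ZMod 2) (Additive (Abelianization W))]

/- Mapping `p` and `q` to two adjacent reflections of a square detects this: an element involving
both of them an odd number of times becomes a rotation of order four. -/
theorem repr_eq_zero_or_of_mul_self_eq_one {p q : B} (hpq : M p q = 0) {a : W} (ha : a * a = 1) :
    (abelianizationBasis cs hM).repr (Additive.ofMul (.of a)) p = 0 ∨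
      (abelianizationBasis cs hM).repr (Additive.ofMul (.of a)) q = 0 := by
  classical
  obtain ⟨δ, hδ⟩ := exists_hom_dihedralGroup cs hM hpq
  have : p ≠ q := by rintro rfl; simp at hpq
  have hp := ofAdd_abelianizationBasis_repr_eq cs hM (s := p) (χ := (dihedralParity 1).comp δ)
    fun t => by
      rw [MonoidHom.comp_apply, hδ, Finsupp.single_apply]
      split_ifs <;> decide
  have hq := ofAdd_abelianizationBasis_repr_eq cs hM (s := q) (χ := (dihedralParity 0).comp δ)
    fun t => by
      rw [MonoidHom.comp_apply, hδ, Finsupp.single_apply]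
      split_ifs <;> first | decide | simp_all
  have hδa : δ a * δ a = 1 := by rw [← map_mul, ha, map_one]
  refine (dihedralParity_eq_one_or_of_mul_self_eq_one hδa).symm.imp (fun h => ?_) fun h => ?_
  · exact ofAdd_eq_one.mp ((hp a).trans h)
  · exact ofAdd_eq_one.mp ((hq a).trans h)

theorem isClique_support_repr_of_mul_self_eq_one {a : W} (ha : a * a = 1) :
    (commGraph M).IsClique ((abelianizationBasis cs hM).repr (Additive.ofMul (.of a))).support := by
  intro s hs t ht hst
  rcases hM s t with h | h | h
  · exact absurd (coxeterMatrix_eq_one_iff.mp h) hst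
  · exact commGraph_adj.mpr h
  · rw [Finset.mem_coe, Finsupp.mem_support_iff] at hs ht
    exact ((repr_eq_zero_or_of_mul_self_eq_one cs hM h ha).elim hs ht).elim

theorem exists_mul_self_eq_one_of_isClique_support {x : Additive (Abelianization W)}
    (hx : (commGraph M).IsClique ((abelianizationBasis cs hM).repr x).support) :
    ∃ a : W, a * a = 1 ∧ .ofMul (.of a) = x := by
  let b := abelianizationBasis cs hM
  have hcomm : ((b.repr x).support : Set B).Pairwise (Function.onFun Commute cs.simple) :=
    fun s hs t ht hst => commute_simple_of_eq_two cs (commGraph_adj.mp (hx hs ht hst))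
  refine ⟨(b.repr x).support.noncommProd cs.simple hcomm, ?_, ?_⟩
  · rw [← Finset.noncommProd_mul_distrib _ _ hcomm hcomm hcomm]
    exact (Finset.noncommProd_eq_pow_card _ _ _ 1 fun s _ => cs.simple_mul_simple_self s).trans
      (one_pow _)
  · have hone (s : B) (hs : s ∈ (b.repr x).support) : b.repr x s = 1 :=
      Fin.eq_one_of_ne_zero _ (Finsupp.mem_support_iff.mp hs)
    rw [Finset.map_noncommProd, Finset.noncommProd_eq_prod, ofMul_prod]
    conv_rhs => rw [← b.linearCombination_repr x, Finsupp.linearCombination_apply, Finsupp.sum]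
    refine Finset.sum_congr rfl fun s hs => ?_
    rw [hone s hs, one_smul, abelianizationBasis_apply]

theorem isClique_support_repr_iff {x : Additive (Abelianization W)} :
    (commGraph M).IsClique ((abelianizationBasis cs hM).repr x).support ↔
      ∃ a : W, a * a = 1 ∧ .ofMul (.of a) = x :=
  ⟨exists_mul_self_eq_one_of_isClique_support cs hM, by
    rintro ⟨a, ha, rfl⟩
    exact isClique_support_repr_of_mul_self_eq_one cs hM ha⟩

end Involutions

section Rigidity

variable {B B' W : Type*} [Group W] {M : CoxeterMatrix B} {M' : CoxeterMatrix B'}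

theorem isomorphic_of_commGraph_iso (hM : M.IsRightAngled) (hM' : M'.IsRightAngled)
    (e : commGraph M ≃g commGraph M') : M.Isomorphic M' := by
  refine ⟨e.toEquiv, fun s t => ?_⟩
  have htwo : M' (e s) (e t) = 2 ↔ M s t = 2 := by
    rw [← commGraph_adj, ← commGraph_adj, e.map_adj_iff]
  have hone : M' (e s) (e t) = 1 ↔ M s t = 1 := by
    rw [coxeterMatrix_eq_one_iff, coxeterMatrix_eq_one_iff, e.injective.eq_iff]
  have h := hM s t
  have h' := hM' (e s) (e t)
  change M' (e s) (e t) = M s t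
  lia

theorem isomorphic_of_isRightAngled (cs : CoxeterSystem M W) (hM : M.IsRightAngled)
    (cs' : CoxeterSystem M' W) (hM' : M'.IsRightAngled) : M.Isomorphic M' := by
  let : Module (ZMod 2) (Additive (Abelianization W)) :=
    AddCommGroup.zmodModule (two_nsmul_abelianization_eq_zero cs)
  obtain ⟨e⟩ := nonempty_iso_of_isClique_support_iff
    (b := abelianizationBasis cs hM) (b' := abelianizationBasis cs' hM') fun x => by
      rw [isClique_support_repr_iff, isClique_support_repr_iff]
  exact isomorphic_of_commGraph_iso hM hM' e

theorem exists_mulEquiv_simple {W' : Type*} [Group W'] (cs : CoxeterSystem M W)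
    (cs' : CoxeterSystem M' W') {e : B ≃ B'} (he : ∀ s t, M' (e s) (e t) = M s t) :
    ∃ α : W ≃* W', ∀ s, α (cs.simple s) = cs'.simple (e s) := by
  obtain rfl : M'.reindex e.symm = M := by
    ext s t
    exact he s t
  refine ⟨cs.mulEquiv.trans (cs'.reindex e.symm).mulEquiv.symm, fun s => ?_⟩
  have hs : cs.mulEquiv (cs.simple s) = (M'.reindex e.symm).simple s :=
    cs.mulEquiv.apply_symm_apply _
  rw [MulEquiv.trans_apply, hs]
  exact cs'.reindex_simple e.symm s

theorem isRightAngled_type (hW : IsRightAngledCoxeterGroup W) {S : Set W}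
    (hS : IsCoxeterSet S) : hS.type.IsRightAngled := by
  obtain ⟨T, hT, hM⟩ := hW
  obtain ⟨cs, -⟩ := hT.presentation
  intro s t
  change orderOf ((s : W) * t) = 1 ∨ orderOf ((s : W) * t) = 2 ∨ orderOf ((s : W) * t) = 0
  by_cases h : IsOfFinOrder ((s : W) * t)
  · have hdvd : orderOf ((s : W) * t) ∣ 2 := orderOf_dvd_of_pow_eq_one
      (by rw [pow_two, mul_self_eq_one_of_isOfFinOrder cs hM h])
    rcases (Nat.dvd_prime Nat.prime_two).mp hdvd with h | h <;> simp [h]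
  · exact Or.inr (Or.inr (orderOf_eq_zero h))

theorem exists_image_eq_of_isomorphic {S S' : Set W} (hS : IsCoxeterSet S) (hS' : IsCoxeterSet S')
    (h : hS.type.Isomorphic hS'.type) : ∃ α : W ≃* W, α '' S = S' := by
  obtain ⟨e, he⟩ := h
  obtain ⟨cs, hcs⟩ := hS.presentation
  obtain ⟨cs', hcs'⟩ := hS'.presentation
  obtain ⟨α, hα⟩ := exists_mulEquiv_simple cs cs' he
  refine ⟨α, ?_⟩
  calc α '' S = Set.range fun s : S => α s := by rw [Set.image_eq_range]
    _ = Set.range fun s : S => (e s : W) := by simp only [← hcs, hα, hcs']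
    _ = S' := (e.surjective.range_comp Subtype.val).trans Subtype.range_coe

end Rigidity

end RightAngledCoxeter

open RightAngledCoxeter in
theorem mainTheorem1 {W : Type*} [Group W] (hW : IsRightAngledCoxeterGroup W) :
    IsRigid W ∧
      ∀ S S' : Set W, IsCoxeterSet S → IsCoxeterSet S' → ∃ α : W ≃* W, α '' S = S' := by
  have hrigid : IsRigid W := by
    intro S S' hS hS'
    obtain ⟨cs, -⟩ := hS.presentation
    obtain ⟨cs', -⟩ := hS'.presentation
    exact isomorphic_of_isRightAngled cs (isRightAngled_type hW hS) cs' (isRightAngled_type hW hS')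
  exact ⟨hrigid, fun S S' hS hS' => exists_image_eq_of_isomorphic hS hS' (hrigid S S' hS hS')⟩
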